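/- Let $\mathcal H=\ell^2(\mathbb Z)$ be the state space of one integer-typed quantum variable $q$, with computational basis $\{|i\rangle\}_{i\in\mathbb Z}$. A quantum predicate is an operator $0\sqsubseteq M\sqsubseteq I$ on $\mathcal H$ ($\sqsubseteq$ is the Löwner order). A quantum operation is a map $\mathcal E=\sum_k E_k\diamond E_k^\dagger$ with $\sum_k E_k^\dagger E_k\sqsubseteq I$, and $\mathcal E^*(A)=\sum_k E_k^\dagger A E_k$. A parameterized quantum predicate term (PQPT) is an expression $\mathcal E^*(X)+\mathcal F^*(I)$ with a predicate variable $X$ (its parameter) or a parameter-free expression $\mathcal F^*(I)$, where $\mathcal E+\mathcal F$ is trace-non-increasing; $P\sqsubseteq Q$ is true if it holds for every assignment of quantum predicates to the predicate variables. Statements are $$S ::= \bot\mid \mathbf{skip}\mid q:=|0\rangle\mid q\mathrel{*}=U\mid S_1;S_2\mid \mathbf{if}(\Box m\cdot M[q]=m\to S_m)\mid \mathbf{call}\ p .$$ Formulas are triples $\{P\}S\{Q\}$ whose PQPTs $P,Q$ have the same parameters. The base system has the axioms $\{I\}\bot\{P\}$, $\{P\}\mathbf{skip}\{P\}$, $\{\sum_i|i\rangle\langle0|P|0\rangle\langle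 i|\}\,q:=|0\rangle\,\{P\}$, $\{U^\dagger PU\}\,q\mathrel{*}=U\,\{P\}$, the composition rule, the rule (R Case): from $\{P_m\}S_m\{Q\}$ for all $m$ infer $\{\sum_m M_m^\dagger P_mM_m\}\,\mathbf{if}(\Box m\cdot M[q]=m\to S_m)\,\{Q\}$, the rule (R Order): from $P\sqsubseteq P'$, $\{P'\}S\{Q'\}$, $Q'\sqsubseteq Q$ infer $\{P\}S\{Q\}$ (all true formulas $P\sqsubseteq Q$ are available), and (R Subst): from $\{P\}S\{Q\}$ infer $\{P[R/X]\}S\{Q[R/X]\}$. The rule (Rp Rec) infers $\{P\}\,\mathbf{call}\ p\,\{Q\}$ if $\{P\}S\{Q\}$, with $S$ the body of $p$, is derivable in the base system (without (Rp Rec)) from the single hypothesis $\{P\}\,\mathbf{call}\ p\,\{Q\}$. A triple $\{P\}S\{Q\}$ is valid (partial correctness) if $P\sqsubseteq wlp.S.Q$ for every assignment, where $wlp$ is the weakest liberal precondition: $wlp.\bot.A=I$, $wlp.\mathbf{skip}.A=A$, $wlp.(q:=|0\rangle).A=\sum_i|i\rangle\langle0|A|0\rangle\langle i|$, $wlp.(q\mathrel{*}=U).A=U^\dagger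 AU$, $wlp.(S_1;S_2).A=wlp.S_1.(wlp.S_2.A)$, $wlp.\mathbf{if}(\Box m\cdot M[q]=m\to S_m).A=\sum_m M_m^\dagger(wlp.S_m.A)M_m$, and $wlp.(\mathbf{call}\ p).A=\bigsqcap_k wlp.S^{(k)}.A$, with $S^{(0)}=\bot$ and $S^{(k+1)}$ obtained from the body $S$ of $p$ by replacing each $\mathbf{call}\ p$ by $\mathbf{skip};S^{(k)}$. Let $U_{+1}|i\rangle=|i+1\rangle$, $U_{-1}|i\rangle=|i-1\rangle$, $M_0=\sum_{i\le0}|i\rangle\langle i|$, $M_1=\sum_{i\ge1}|i\rangle\langle i|$, and let the only declared procedure $\mathrm{toy}$ have the body $\mathbf{if}(\Box m\cdot M[q]=m\to S_m)$ with $S_0=\mathbf{skip}$ and $S_1=q\mathrel{*}=U_{-1};\ \mathbf{call}\ \mathrm{toy};\ q\mathrel{*}=U_{+1}$. Then for every integer $n\ge0$: 1. $\{|n\rangle\langle n|\}\,\mathbf{call}\ \mathrm{toy}\,\{|n\rangle\langle n|\}$ is derivable in the base system together with (Rp Rec). 2. It is not derivable if (R Subst) is removed, both from the derivation and from the base system referred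 to in (Rp Rec). 3. If only parameter-free terms (i.e. quantum predicates) are admitted in all triples, then this triple is valid but not derivable in the base system together with (Rp Rec). Hence, with non-parameterized quantum predicates, the base system with the recursion rule (Rp Rec) is incomplete: some valid triple is not derivable. -/

import Mathlib

open scoped InnerProductSpace ENNReal NNReal ComplexOrder

noncomputable section

namespace QuantumRec

/-! ### The state space of one integer-typed quantum variable -/

/-- State Hilbert space of a quantum variable of type integer: `ℓ²(ℤ)`. -/
abbrev Hq : Type := lp (fun _ : ℤ => ℂ) 2

/-- Bounded operators; `≤` on them is the Löwner order of Mathlib. -/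
abbrev Op : Type := Hq →L[ℂ] Hq

/-- The computational basis vector `|i⟩`. -/
def ket (i : ℤ) : Hq := lp.single 2 i 1

/-- The outer product `|i⟩⟨j|`. -/
def ketbra (i j : ℤ) : Op := InnerProductSpace.rankOne ℂ (ket i) (ket j)

lemma norm_sq_eq_tsum (f : Hq) : ‖f‖ₑ ^ 2 = ∑' i, ‖f i‖ₑ ^ 2 := by
  have h := lp.hasSum_norm (p := 2) (by norm_num) f
  simp only [ENNReal.toReal_ofNat, Real.rpow_ofNat] at h
  rw [← ofReal_norm, ← ENNReal.ofReal_pow (norm_nonneg _), ← h.tsum_eq,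
    ENNReal.ofReal_tsum_of_nonneg (fun _ => by positivity) h.summable]
  congr 1; ext i
  rw [ENNReal.ofReal_pow (norm_nonneg _), ofReal_norm]

lemma ketbra_apply (i j : ℤ) (ψ : Hq) : ketbra i j ψ = ψ j • ket i := by
  simp [ketbra, ket, lp.inner_single_left]

lemma enorm_ket (i : ℤ) : ‖ket i‖ₑ = 1 := by
  rw [← ofReal_norm, ket, lp.norm_single (by norm_num)]; simp

/-! ### Quantum operations in Kraus form, and their duals -/

/-- A (bounded, completely positive) super-operator `𝓔 = ∑ₖ Eₖ ⋄ Eₖ†` in Kraus form. -/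
structure SuperOp where
  ι : Type
  kraus : ι → Op
  bounded : ∃ C : ℝ≥0, ∀ ψ : Hq, ∑' k, ‖kraus k ψ‖ₑ ^ 2 ≤ C * ‖ψ‖ₑ ^ 2

namespace SuperOp

/-- `tr 𝓔(|ψ⟩⟨ψ|) = ∑ₖ ‖Eₖ ψ‖²`. -/
def outTrace (E : SuperOp) (ψ : Hq) : ℝ≥0∞ := ∑' k, ‖E.kraus k ψ‖ₑ ^ 2

/-- `𝓔` is a quantum operation: it does not increase the trace, i.e. `∑ₖ Eₖ† Eₖ ⊑ I`. -/
def IsQOp (E : SuperOp) : Prop := ∀ ψ : Hq, E.outTrace ψ ≤ ‖ψ‖ₑ ^ 2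

lemma exists_bound (E : SuperOp) (A : Op) :
    ∃ C : ℝ≥0, ∀ ψ : Hq, ∑' k, ‖A (E.kraus k ψ)‖ₑ ^ 2 ≤ C * ‖ψ‖ₑ ^ 2 := by
  obtain ⟨C, hC⟩ := E.bounded
  refine ⟨‖A‖₊ ^ 2 * C, fun ψ => ?_⟩
  calc ∑' k, ‖A (E.kraus k ψ)‖ₑ ^ 2 ≤ ∑' k, (‖A‖ₑ ^ 2 * ‖E.kraus k ψ‖ₑ ^ 2) := by
        refine ENNReal.tsum_le_tsum fun k => ?_
        rw [← mul_pow]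
        gcongr
        exact A.le_opENorm _
    _ = ‖A‖ₑ ^ 2 * ∑' k, ‖E.kraus k ψ‖ₑ ^ 2 := ENNReal.tsum_mul_left
    _ ≤ ‖A‖ₑ ^ 2 * (C * ‖ψ‖ₑ ^ 2) := by gcongr; exact hC ψ
    _ = _ := by simp [mul_assoc, enorm_eq_nnnorm]

lemma memℓp (E : SuperOp) (A : Op) (ψ : Hq) :
    Memℓp (fun k => A (E.kraus k ψ)) 2 := by
  obtain ⟨C, hC⟩ := E.exists_bound A
  refine memℓp_gen ?_
  have h : ∑' k, ‖A (E.kraus k ψ)‖ₑ ^ 2 ≠ ∞ :=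
    ne_top_of_le_ne_top (by finiteness) (hC ψ)
  have h' := ENNReal.summable_toReal h
  simpa using h'

/-- The bounded operator `ψ ↦ (A Eₖ ψ)ₖ` from `ℓ²(ℤ)` to the Hilbert sum over the Kraus index. -/
def column (E : SuperOp) (A : Op) : Hq →L[ℂ] lp (fun _ : E.ι => Hq) 2 :=
  LinearMap.mkContinuousOfExistsBound
    { toFun := fun ψ => ⟨fun k => A (E.kraus k ψ), E.memℓp A ψ⟩
      map_add' := fun x y => by ext1; funext k; simp; rfl
      map_smul' := fun c x => by ext1; funext k; simp } <| by
    obtain ⟨C, hC⟩ := E.exists_bound A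
    refine ⟨NNReal.sqrt C, fun ψ => ?_⟩
    refine lp.norm_le_of_forall_sum_le (by norm_num) (by positivity) fun s => ?_
    have h : (∑ k ∈ s, ‖A (E.kraus k ψ)‖ₑ ^ 2) ≤ C * ‖ψ‖ₑ ^ 2 :=
      (ENNReal.sum_le_tsum s).trans (hC ψ)
    have h2 := ENNReal.toReal_mono (by finiteness) h
    rw [ENNReal.toReal_sum (fun _ _ => by finiteness)] at h2
    simp only [ENNReal.toReal_pow, toReal_enorm, ENNReal.toReal_mul, ENNReal.coe_toReal] at h2
    simp only [ENNReal.toReal_ofNat, Real.rpow_ofNat, mul_pow]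
    refine le_trans (by simpa using h2) (le_of_eq ?_)
    congr 1
    exact_mod_cast (NNReal.sq_sqrt C).symm

/-- The Schrödinger–Heisenberg dual `𝓔*(A) = ∑ₖ Eₖ† A Eₖ`; see `hasSum_dual`. -/
def dual (E : SuperOp) (A : Op) : Op :=
  (ContinuousLinearMap.adjoint (E.column 1)) ∘L (E.column A)

theorem hasSum_dual (E : SuperOp) (A : Op) (φ ψ : Hq) :
    HasSum (fun k => ⟪φ, (star (E.kraus k) * A * E.kraus k) ψ⟫_ℂ) ⟪φ, E.dual A ψ⟫_ℂ := by
  have h := lp.hasSum_inner (𝕜 := ℂ) (E.column 1 φ) (E.column A ψ)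
  simp only [dual, ContinuousLinearMap.comp_apply, ContinuousLinearMap.adjoint_inner_right,
    mul_apply_eq_comp, ContinuousLinearMap.star_eq_adjoint]
  exact h

/-- The sum `𝓔 + 𝓕`. -/
def add (E F : SuperOp) : SuperOp where
  ι := E.ι ⊕ F.ι
  kraus := Sum.elim E.kraus F.kraus
  bounded := by
    obtain ⟨C, hC⟩ := E.bounded
    obtain ⟨D, hD⟩ := F.bounded
    refine ⟨C + D, fun ψ => ?_⟩
    rw [Summable.tsum_sum ENNReal.summable ENNReal.summable]
    push_cast
    rw [add_mul]
    exact add_le_add (hC ψ) (hD ψ)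

/-- `𝓔 ∘ 𝓕`: first `𝓕`, then `𝓔`. -/
def comp (E F : SuperOp) : SuperOp where
  ι := F.ι × E.ι
  kraus := fun k => E.kraus k.2 * F.kraus k.1
  bounded := by
    obtain ⟨C, hC⟩ := E.bounded
    obtain ⟨D, hD⟩ := F.bounded
    refine ⟨C * D, fun ψ => ?_⟩
    rw [ENNReal.tsum_prod']
    calc ∑' a, ∑' b, ‖(E.kraus b * F.kraus a) ψ‖ₑ ^ 2
        ≤ ∑' a, (C : ℝ≥0∞) * ‖F.kraus a ψ‖ₑ ^ 2 := ENNReal.tsum_le_tsum fun a => hC _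
      _ = C * ∑' a, ‖F.kraus a ψ‖ₑ ^ 2 := ENNReal.tsum_mul_left
      _ ≤ C * (D * ‖ψ‖ₑ ^ 2) := by gcongr; exact hD ψ
      _ = _ := by push_cast; ring

/-- A finite sum `∑ₘ 𝓔ₘ`. -/
def sum {k : ℕ} (E : Fin k → SuperOp) : SuperOp where
  ι := Σ m, (E m).ι
  kraus := fun p => (E p.1).kraus p.2
  bounded := by
    choose C hC using fun m => (E m).bounded
    refine ⟨∑ m, C m, fun ψ => ?_⟩
    rw [ENNReal.tsum_sigma', tsum_fintype]
    push_cast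
    rw [Finset.sum_mul]
    exact Finset.sum_le_sum fun m _ => hC m ψ

/-- `A ⋄ A†`. -/
def ofOp (A : Op) : SuperOp where
  ι := Unit
  kraus := fun _ => A
  bounded := ⟨‖A‖₊ ^ 2, fun ψ => by
    simp only [tsum_fintype, Finset.univ_unique, Finset.sum_const, Finset.card_singleton, one_smul]
    push_cast
    rw [← mul_pow, ← enorm_eq_nnnorm]
    gcongr
    exact A.le_opENorm ψ⟩

/-- The initialization `∑ᵢ |0⟩⟨i| ⋄ |i⟩⟨0|`. -/
def init : SuperOp where
  ι := ℤ
  kraus := fun i => ketbra 0 i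
  bounded := ⟨1, fun ψ => by
    rw [norm_sq_eq_tsum]
    simp [ketbra_apply, enorm_smul, enorm_ket]⟩

lemma outTrace_add (E F : SuperOp) (ψ : Hq) :
    (E.add F).outTrace ψ = E.outTrace ψ + F.outTrace ψ :=
  Summable.tsum_sum ENNReal.summable ENNReal.summable

lemma outTrace_comp (E F : SuperOp) (ψ : Hq) :
    (E.comp F).outTrace ψ = ∑' k, E.outTrace (F.kraus k ψ) :=
  ENNReal.tsum_prod' (f := fun p : F.ι × E.ι => ‖(E.kraus p.2 * F.kraus p.1) ψ‖ₑ ^ 2)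

lemma outTrace_sum {k : ℕ} (E : Fin k → SuperOp) (ψ : Hq) :
    (sum E).outTrace ψ = ∑ m, (E m).outTrace ψ := by
  rw [← tsum_fintype (L := .unconditional _)]
  exact ENNReal.tsum_sigma' (f := fun p : Σ m, (E m).ι => ‖(E p.1).kraus p.2 ψ‖ₑ ^ 2)

lemma outTrace_ofOp (A : Op) (ψ : Hq) : (ofOp A).outTrace ψ = ‖A ψ‖ₑ ^ 2 := by
  simp [outTrace, ofOp]

lemma isQOp_init : init.IsQOp := fun ψ => by
  rw [norm_sq_eq_tsum]
  simp [outTrace, init, ketbra_apply, enorm_smul, enorm_ket]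

lemma dual_add (E F : SuperOp) (A : Op) : (E.add F).dual A = E.dual A + F.dual A := by
  refine ContinuousLinearMap.ext fun ψ => ext_inner_left ℂ fun φ => ?_
  rw [add_apply, inner_add_right]
  refine ((E.add F).hasSum_dual A φ ψ).unique ?_
  exact HasSum.sum (E.hasSum_dual A φ ψ) (F.hasSum_dual A φ ψ)

lemma dual_comp (E F : SuperOp) (A : Op) : (E.comp F).dual A = F.dual (E.dual A) := by
  refine ContinuousLinearMap.ext fun ψ => ext_inner_left ℂ fun φ => ?_
  refine (((E.comp F).hasSum_dual A φ ψ).prod_fiberwise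
    (g := fun k => ⟪φ, (star (F.kraus k) * E.dual A * F.kraus k) ψ⟫_ℂ) fun k => ?_).unique
    (F.hasSum_dual (E.dual A) φ ψ)
  have h := E.hasSum_dual A (F.kraus k φ) (F.kraus k ψ)
  simp only [ContinuousLinearMap.star_eq_adjoint, mul_apply_eq_comp,
    ContinuousLinearMap.adjoint_inner_right, comp] at h ⊢
  simpa [mul_assoc] using h

lemma dual_sum {k : ℕ} (E : Fin k → SuperOp) (A : Op) :
    (sum E).dual A = ∑ m, (E m).dual A := by
  refine ContinuousLinearMap.ext fun ψ => ext_inner_left ℂ fun φ => ?_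
  rw [sum_apply, inner_sum]
  exact (HasSum.sigma (g := fun m => ⟪φ, (E m).dual A ψ⟫_ℂ) ((sum E).hasSum_dual A φ ψ)
    fun m => (E m).hasSum_dual A φ ψ).unique (hasSum_fintype _)

lemma dual_ofOp (A B : Op) : (ofOp A).dual B = star A * B * A := by
  refine ContinuousLinearMap.ext fun ψ => ext_inner_left ℂ fun φ => ?_
  exact ((ofOp A).hasSum_dual B φ ψ).unique (hasSum_unique (β := Unit) _)

lemma dual_map_add (E : SuperOp) (A B : Op) : E.dual (A + B) = E.dual A + E.dual B := by
  refine ContinuousLinearMap.ext fun ψ => ext_inner_left ℂ fun φ => ?_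
  rw [add_apply, inner_add_right]
  refine (E.hasSum_dual (A + B) φ ψ).unique ?_
  simpa [mul_add, add_mul, inner_add_right] using
    (E.hasSum_dual A φ ψ).add (E.hasSum_dual B φ ψ)

end SuperOp

/-! ### Quantum predicates and parameterized quantum predicate terms -/

/-- Quantum predicates: `0 ⊑ M ⊑ I`. -/
def QPred : Type := {M : Op // 0 ≤ M ∧ M ≤ 1}

/-- A parameterized quantum predicate term `𝓔*(𝓑) + 𝓕*(I)` on the quantum variable, where
`𝓔 + 𝓕` is a quantum operation (hence so are `𝓔` and `𝓕`). The index `x` is the parameter set, which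
has at most one element as there is one quantum variable only: the base `𝓑` is the predicate
variable `X` if `x = some X`; if `x = none` then there is no parameter, and `𝓑` is `I`. `V` is the
type of available quantum predicate variables; for empty `V`, only parameter-free terms exist. -/
structure PQPT {V : Type} (x : Option V) : Type 1 where
  E : SuperOp
  F : SuperOp
  isQOp : (E.add F).IsQOp

namespace PQPT
variable {V : Type} {x y : Option V}

/-- Denotation of the base under an assignment. -/
def base (v : V → QPred) : Option V → Op
  | none => 1
  | some X => (v X).1

/-- Denotation of a term under an assignment `v` of quantum predicates to the variables. -/
def denote (v : V → QPred) (P : PQPT x) : Op := P.E.dual (base v x) + P.F.dual 1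

/-- The formula `P ⊑ Q` is true: the Löwner order holds under every assignment. -/
def Le (P Q : PQPT x) : Prop := ∀ v : V → QPred, P.denote v ≤ Q.denote v

lemma outTrace_le (P : PQPT x) (ψ : Hq) : P.E.outTrace ψ + P.F.outTrace ψ ≤ ‖ψ‖ₑ ^ 2 :=
  (P.E.outTrace_add P.F ψ).symm.trans_le (P.isQOp ψ)

/-- The identity `I = 0*(𝓑) + I I I`. -/
def top (x : Option V) : PQPT x where
  E := .ofOp 0
  F := .ofOp 1
  isQOp := fun ψ => by simp [SuperOp.outTrace_add, SuperOp.outTrace_ofOp]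

/-- The quantum predicate `|n⟩⟨n|`, as a parameter-free term. -/
def ketbra (n : ℤ) : PQPT (none : Option V) where
  E := .ofOp 0
  F := .ofOp (QuantumRec.ketbra n n)
  isQOp := fun ψ => by
    have h : ‖ψ n‖ₑ ≤ ‖ψ‖ₑ := by
      rw [← ofReal_norm, ← ofReal_norm]
      exact ENNReal.ofReal_le_ofReal (lp.norm_apply_le_norm (by norm_num) ψ n)
    simp only [SuperOp.outTrace_add, SuperOp.outTrace_ofOp, ketbra_apply, enorm_smul, enorm_ket]
    simpa using by gcongr

/-- `𝓖*(P)` for a quantum operation `𝓖`. -/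
def pull (G : SuperOp) (hG : G.IsQOp) (P : PQPT x) : PQPT x where
  E := P.E.comp G
  F := P.F.comp G
  isQOp := fun ψ => by
    rw [SuperOp.outTrace_add, SuperOp.outTrace_comp, SuperOp.outTrace_comp,
      ← Summable.tsum_add ENNReal.summable ENNReal.summable]
    exact (ENNReal.tsum_le_tsum fun k => P.outTrace_le _).trans (hG ψ)

/-- The disjunction `∑ₘ 𝓖ₘ*(Pₘ)` of terms with the same parameters. -/
def disj {k : ℕ} (G : Fin k → SuperOp) (hG : (SuperOp.sum G).IsQOp) (P : Fin k → PQPT x) :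
    PQPT x where
  E := .sum fun m => (P m).E.comp (G m)
  F := .sum fun m => (P m).F.comp (G m)
  isQOp := fun ψ => by
    rw [SuperOp.outTrace_add, SuperOp.outTrace_sum, SuperOp.outTrace_sum,
      ← Finset.sum_add_distrib]
    refine (Finset.sum_le_sum fun m _ => ?_).trans
      ((SuperOp.outTrace_sum G ψ).symm.trans_le (hG ψ))
    rw [SuperOp.outTrace_comp, SuperOp.outTrace_comp,
      ← Summable.tsum_add ENNReal.summable ENNReal.summable]
    exact ENNReal.tsum_le_tsum fun k => (P m).outTrace_le _

/-- The substitution `P[R/X]`. (If `X` is not the parameter of `P`, then `P[R/X]` is `P`, and the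
substitution rule is trivial.) -/
def subst {X : V} (P : PQPT (some X)) (R : PQPT y) : PQPT y where
  E := R.E.comp P.E
  F := (R.F.comp P.E).add P.F
  isQOp := fun ψ => by
    rw [SuperOp.outTrace_add, SuperOp.outTrace_add, SuperOp.outTrace_comp, SuperOp.outTrace_comp,
      ← add_assoc, ← Summable.tsum_add ENNReal.summable ENNReal.summable]
    refine le_trans ?_ (P.outTrace_le ψ)
    gcongr
    exact ENNReal.tsum_le_tsum fun k => R.outTrace_le _

lemma denote_top (v : V → QPred) : (top x).denote v = 1 := by
  simp [denote, top, SuperOp.dual_ofOp]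

lemma denote_ketbra (v : V → QPred) (n : ℤ) :
    (ketbra n : PQPT (none : Option V)).denote v = QuantumRec.ketbra n n := by
  simp only [denote, ketbra, SuperOp.dual_ofOp, star_zero, zero_mul, mul_one, zero_add,
    ContinuousLinearMap.star_eq_adjoint]
  ext ψ i
  simp [QuantumRec.ketbra, ket, lp.inner_single_left]

lemma denote_pull (v : V → QPred) (G : SuperOp) (hG : G.IsQOp) (P : PQPT x) :
    (pull G hG P).denote v = G.dual (P.denote v) := by
  simp only [denote, pull, SuperOp.dual_comp, SuperOp.dual_map_add]

lemma denote_disj (v : V → QPred) {k : ℕ} (G : Fin k → SuperOp) (hG : (SuperOp.sum G).IsQOp)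
    (P : Fin k → PQPT x) : (disj G hG P).denote v = ∑ m, (G m).dual ((P m).denote v) := by
  simp only [denote, disj, SuperOp.dual_sum, SuperOp.dual_comp, SuperOp.dual_map_add,
    Finset.sum_add_distrib]

lemma denote_subst (v : V → QPred) {X : V} (P : PQPT (some X)) (R : PQPT y) :
    (P.subst R).denote v = P.E.dual (R.denote v) + P.F.dual 1 := by
  simp only [denote, subst, SuperOp.dual_add, SuperOp.dual_comp, SuperOp.dual_map_add]
  abel

end PQPT

/-! ### Recursive quantum programs -/

/-- A measurement `{Mₘ}ₘ` with `∑ₘ Mₘ† Mₘ = I`. -/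
structure Measurement (k : ℕ) where
  op : Fin k → Op
  complete : ∑ m, star (op m) * op m = 1

/-- Statements over the quantum variable, with procedure names from `N`. -/
inductive Stmt (N : Type) : Type
  | bottom : Stmt N
  | skip : Stmt N
  | init : Stmt N
  | unit (U : unitary Op) : Stmt N
  | seq (S₁ S₂ : Stmt N) : Stmt N
  | case {k : ℕ} (M : Measurement k) (S : Fin k → Stmt N) : Stmt N
  | call (p : N) : Stmt N

namespace Stmt
variable {N : Type}

/-- Replace each `call p` by `skip; T p`. -/
def unfold (T : N → Stmt N) : Stmt N → Stmt N
  | bottom => bottom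
  | skip => skip
  | init => init
  | unit U => unit U
  | seq S₁ S₂ => seq (unfold T S₁) (unfold T S₂)
  | case M S => case M fun m => unfold T (S m)
  | call p => seq skip (T p)

/-- The `k`-th syntactic approximations of the bodies of the procedures declared by `D`. -/
def approx (D : N → Stmt N) : ℕ → N → Stmt N
  | 0, _ => bottom
  | k + 1, p => unfold (approx D k) (D p)

end Stmt

lemma le_iff_inner {H : Type} [NormedAddCommGroup H] [InnerProductSpace ℂ H]
    (A B : H →L[ℂ] H) : A ≤ B ↔ ∀ ψ, ⟪A ψ, ψ⟫_ℂ ≤ ⟪B ψ, ψ⟫_ℂ := by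
  rw [ContinuousLinearMap.le_def]
  constructor
  · intro h ψ
    have := h.inner_nonneg_left ψ
    rwa [sub_apply, inner_sub_left, sub_nonneg] at this
  · intro h
    rw [ContinuousLinearMap.isPositive_iff_complex]
    intro ψ
    have h' : 0 ≤ ⟪(B - A) ψ, ψ⟫_ℂ := by
      rw [sub_apply, inner_sub_left, sub_nonneg]; exact h ψ
    rw [Complex.le_def] at h'
    refine ⟨Complex.ext (by simp) ?_, h'.1⟩
    exact h'.2

lemma norm_apply_sq_le {H : Type} [NormedAddCommGroup H] [InnerProductSpace ℂ H]
    [CompleteSpace H]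
    (B : H →L[ℂ] H) (hB : 0 ≤ B) (ψ : H) :
    ‖B ψ‖ ^ 2 ≤ ‖B‖ * (⟪B ψ, ψ⟫_ℂ).re := by
  set S : H →L[ℂ] H := CFC.sqrt B with hS
  have hSB : S * S = B := CFC.sqrt_mul_sqrt_self B hB
  have hS0 : IsSelfAdjoint S := IsSelfAdjoint.of_nonneg (CFC.sqrt_nonneg B)
  have h1 : ‖S‖ ^ 2 = ‖B‖ := by
    rw [sq, ← CStarRing.norm_star_mul_self, hS0.star_eq, hSB]
  have h2 : ‖S ψ‖ ^ 2 = (⟪B ψ, ψ⟫_ℂ).re := by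
    rw [← hSB, mul_apply_eq_comp, ← ContinuousLinearMap.adjoint_inner_right,
      ← ContinuousLinearMap.star_eq_adjoint, hS0.star_eq]
    exact (inner_self_eq_norm_sq (𝕜 := ℂ) (S ψ)).symm
  calc ‖B ψ‖ ^ 2 = ‖S (S ψ)‖ ^ 2 := by rw [← mul_apply_eq_comp, hSB]
    _ ≤ (‖S‖ * ‖S ψ‖) ^ 2 := by gcongr; exact S.le_opNorm _
    _ = _ := by rw [mul_pow, h1, h2]

/-- Non-increasing sequences of positive operators have a greatest lower bound. -/
theorem exists_isGLB {H : Type} [NormedAddCommGroup H] [InnerProductSpace ℂ H]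
    [CompleteSpace H]
    (A : ℕ → H →L[ℂ] H) (hA : Antitone A) (h0 : ∀ n, 0 ≤ A n) :
    ∃ T, IsGLB (Set.range A) T := by
  have hc : ∀ ψ, CauchySeq fun n => A n ψ := by
    intro ψ
    set q : ℕ → ℝ := fun n => (⟪A n ψ, ψ⟫_ℂ).re with hq
    have hqa : Antitone q := fun m n h =>
      (Complex.le_def.1 ((le_iff_inner _ _).1 (hA h) ψ)).1
    have hqb : BddBelow (Set.range q) := ⟨0, by
      rintro _ ⟨n, rfl⟩
      have := (Complex.le_def.1 ((le_iff_inner _ _).1 (h0 n) ψ)).1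
      simpa using this⟩
    have hqc : CauchySeq q := (tendsto_atTop_ciInf hqa hqb).cauchySeq
    have hb : ∀ m n, m ≤ n → ‖A m ψ - A n ψ‖ ^ 2 ≤ ‖A 0‖ * (q m - q n) := by
      intro m n h
      have h1 := norm_apply_sq_le (A m - A n) (sub_nonneg.2 (hA h)) ψ
      have h2 : ‖A m - A n‖ ≤ ‖A 0‖ := by
        refine CStarAlgebra.norm_le_norm_of_nonneg_of_le (sub_nonneg.2 (hA h)) ?_
        exact (sub_le_self _ (h0 n)).trans (hA (Nat.zero_le m))
      rw [sub_apply, inner_sub_left, Complex.sub_re] at h1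
      refine h1.trans (mul_le_mul_of_nonneg_right h2 ?_)
      exact sub_nonneg.2 (hqa h)
    rw [Metric.cauchySeq_iff'] at hqc ⊢
    intro ε hε
    obtain ⟨N, hN⟩ := hqc (ε ^ 2 / (‖A 0‖ + 1)) (by positivity)
    refine ⟨N, fun n hn => ?_⟩
    have h1 := hN n hn
    rw [Real.dist_eq, abs_sub_comm, abs_of_nonneg (sub_nonneg.2 (hqa hn)),
      lt_div_iff₀ (by positivity)] at h1
    have h2 := hb N n hn
    have h3 : 0 ≤ q N - q n := sub_nonneg.2 (hqa hn)
    rw [dist_comm, dist_eq_norm]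
    exact lt_of_pow_lt_pow_left₀ 2 hε.le (by nlinarith)
  choose f hf using fun ψ => cauchySeq_tendsto_of_complete (hc ψ)
  let T : H →L[ℂ] H := continuousLinearMapOfTendsto A (tendsto_pi_nhds.2 hf)
  have hT : ∀ ψ, Filter.Tendsto (fun n => ⟪A n ψ, ψ⟫_ℂ) Filter.atTop (nhds ⟪T ψ, ψ⟫_ℂ) :=
    fun ψ => (hf ψ).inner tendsto_const_nhds
  refine ⟨T, ?_, ?_⟩
  · rintro _ ⟨n, rfl⟩
    rw [le_iff_inner]
    intro ψ
    refine le_of_tendsto (hT ψ) ?_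
    filter_upwards [Filter.eventually_ge_atTop n] with m hm
    exact (le_iff_inner _ _).1 (hA hm) ψ
  · intro B hB
    rw [le_iff_inner]
    intro ψ
    exact ge_of_tendsto' (hT ψ) fun n => (le_iff_inner _ _).1 (hB ⟨n, rfl⟩) ψ

/-- The greatest lower bound, in the Löwner order, of a sequence of operators. It exists for
non-increasing sequences of positive operators, see `exists_isGLB`. -/
def lowerLimit (A : ℕ → Op) : Op := Classical.epsilon fun T => IsGLB (Set.range A) T

/-- The clauses of the weakest liberal precondition, `c p` being the transformer for `call p`. -/
def wlpWith {N : Type} (c : N → Op → Op) : Stmt N → Op → Op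
  | .bottom, _ => 1
  | .skip, A => A
  | .init, A => SuperOp.init.dual A
  | .unit U, A => star (U : Op) * A * (U : Op)
  | .seq S₁ S₂, A => wlpWith c S₁ (wlpWith c S₂ A)
  | .case M S, A => ∑ m, star (M.op m) * wlpWith c (S m) A * M.op m
  | .call p, A => c p A

/-- The weakest liberal precondition of a statement under the declarations `D`. For `call p` it is
the lower limit of those of the syntactic approximations of the body of `p`; these contain no calls,
so that the transformer passed for calls is immaterial there. -/
def wlp {N : Type} (D : N → Stmt N) : Stmt N → Op → Op :=
  wlpWith fun p A => lowerLimit fun k => wlpWith (fun _ _ => 1) (Stmt.approx D k p) A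

/-! ### Hoare triples, partial correctness and the proof systems -/

/-- A partial-correctness formula `{P} S {Q}`, with `P` and `Q` having the same parameters. -/
structure Triple (V N : Type) : Type 1 where
  {x : Option V}
  pre : PQPT x
  prog : Stmt N
  post : PQPT x

/-- Validity (partial correctness): `P ⊑ wlp.S.Q` under every assignment. -/
def Valid {V N : Type} (D : N → Stmt N) (t : Triple V N) : Prop :=
  ∀ v : V → QPred, t.pre.denote v ≤ wlp D t.prog (t.post.denote v)

lemma isQOp_unit (U : unitary Op) : (SuperOp.ofOp (U : Op)).IsQOp := fun ψ => by
  rw [SuperOp.outTrace_ofOp, ← ofReal_norm, ← ofReal_norm]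
  exact (congrArg (fun r => ENNReal.ofReal r ^ 2)
    ((Unitary.linearIsometryEquiv U).norm_map ψ)).le

lemma Measurement.isQOp {k : ℕ} (M : Measurement k) :
    (SuperOp.sum fun m => SuperOp.ofOp (M.op m)).IsQOp := fun ψ => by
  simp only [SuperOp.outTrace_sum, SuperOp.outTrace_ofOp, ← ofReal_norm,
    ← ENNReal.ofReal_pow (norm_nonneg _)]
  rw [← ENNReal.ofReal_sum_of_nonneg (fun _ _ => by positivity)]
  refine ENNReal.ofReal_le_ofReal (le_of_eq ?_)
  have h := congrArg (fun A : Op => RCLike.re ⟪ψ, A ψ⟫_ℂ) M.complete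
  simp only [sum_apply, inner_sum, mul_apply_eq_comp, ContinuousLinearMap.star_eq_adjoint,
    ContinuousLinearMap.adjoint_inner_right, map_sum, one_apply_eq_self,
    inner_self_eq_norm_sq] at h
  exact h

/-- Derivability from the hypotheses `Γ` in the base proof system; all true formulas `P ⊑ Q` are
available to the order rule. The substitution rule is available if and only if `useSubst`. -/
inductive QBase {V N : Type} (useSubst : Prop) (Γ : Set (Triple V N)) : Triple V N → Prop
  | hyp {t : Triple V N} : t ∈ Γ → QBase useSubst Γ t
  | bottom {x : Option V} (P : PQPT x) : QBase useSubst Γ ⟨.top x, .bottom, P⟩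
  | skip {x : Option V} (P : PQPT x) : QBase useSubst Γ ⟨P, .skip, P⟩
  | init {x : Option V} (P : PQPT x) :
      QBase useSubst Γ ⟨P.pull .init SuperOp.isQOp_init, .init, P⟩
  | unit {x : Option V} (U : unitary Op) (P : PQPT x) :
      QBase useSubst Γ ⟨P.pull (.ofOp U) (isQOp_unit U), .unit U, P⟩
  | comp {x : Option V} {P Q R : PQPT x} {S₁ S₂ : Stmt N} :
      QBase useSubst Γ ⟨P, S₁, Q⟩ → QBase useSubst Γ ⟨Q, S₂, R⟩ →
      QBase useSubst Γ ⟨P, .seq S₁ S₂, R⟩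
  | case {x : Option V} {k : ℕ} (M : Measurement k) {P : Fin k → PQPT x} {S : Fin k → Stmt N}
      {Q : PQPT x} : (∀ m, QBase useSubst Γ ⟨P m, S m, Q⟩) →
      QBase useSubst Γ ⟨.disj (fun m => .ofOp (M.op m)) M.isQOp P, .case M S, Q⟩
  | order {x : Option V} {P P' Q Q' : PQPT x} {S : Stmt N} : P.Le P' →
      QBase useSubst Γ ⟨P', S, Q'⟩ → Q'.Le Q → QBase useSubst Γ ⟨P, S, Q⟩
  | subst {X : V} {y : Option V} {P Q : PQPT (some X)} {S : Stmt N} (R : PQPT y) : useSubst →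
      QBase useSubst Γ ⟨P, S, Q⟩ → QBase useSubst Γ ⟨P.subst R, S, Q.subst R⟩

/-- The conclusions `{P} call p {Q}` of instances of the recursion rule for partial correctness:
`{P} S {Q}`, for the body `S` of `p`, is derivable in the base system from `{P} call p {Q}`. -/
def recConclusions {V N : Type} (useSubst : Prop) (D : N → Stmt N) : Set (Triple V N) :=
  {t | ∃ (x : Option V) (P Q : PQPT x) (p : N), t = ⟨P, .call p, Q⟩ ∧
    QBase useSubst {⟨P, .call p, Q⟩} ⟨P, D p, Q⟩}

/-- Derivability in the base system extended by the recursion rule. As the premise of the recursion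
rule is a derivability assertion about the base system, a derivation is one in the base
system that may start from any conclusion of the recursion rule. -/
def Derivable {V N : Type} (useSubst : Prop) (D : N → Stmt N) (t : Triple V N) : Prop :=
  QBase useSubst (recConclusions useSubst D) t

/-- Relative completeness of the extended system for programs with declarations `D` and terms
with quantum predicate variables from `V`. -/
def IsComplete (V : Type) {N : Type} (useSubst : Prop) (D : N → Stmt N) : Prop :=
  ∀ t : Triple V N, Valid D t → Derivable useSubst D t

/-! ### The procedure `toy` -/

/-- The projection `∑_{i ∈ s} |i⟩⟨i|`; see `proj_ket`. -/
def proj (s : Set ℤ) : Op :=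
  LinearMap.mkContinuous
    { toFun := fun f => ⟨s.indicator f, (lp.memℓp f).mono' fun i => by
        by_cases h : i ∈ s <;> simp [h]⟩
      map_add' := fun f g => by ext1; exact Set.indicator_add s f g
      map_smul' := fun c f => by ext i; by_cases h : i ∈ s <;> simp [h] } 1 fun f => by
    rw [one_mul]
    exact lp.norm_mono (by norm_num) fun i => by by_cases h : i ∈ s <;> simp [h]

lemma proj_apply (s : Set ℤ) (f : Hq) (i : ℤ) : proj s f i = s.indicator f i := rfl

open Classical in
lemma proj_ket (s : Set ℤ) (i : ℤ) : proj s (ket i) = if i ∈ s then ket i else 0 := by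
  ext j
  by_cases hi : i ∈ s <;> by_cases hj : j ∈ s <;> by_cases h : j = i <;>
    simp_all [proj_apply, ket]

lemma star_proj_mul_proj (s : Set ℤ) : star (proj s) * proj s = proj s := by
  refine ContinuousLinearMap.ext fun ψ => ext_inner_left ℂ fun φ => ?_
  rw [mul_apply_eq_comp, ContinuousLinearMap.star_eq_adjoint,
    ContinuousLinearMap.adjoint_inner_right, lp.inner_eq_tsum, lp.inner_eq_tsum]
  congr 1; ext i
  by_cases h : i ∈ s <;> simp [proj_apply, h]

lemma shift_memℓp (d : ℤ) (f : Hq) : Memℓp (fun i => f (i - d)) 2 := by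
  refine memℓp_gen ?_
  have h := (lp.hasSum_norm (p := 2) (by norm_num) f).summable
  exact (Equiv.subRight d).summable_iff.mpr h

lemma shift_norm (d : ℤ) (f : Hq) (h : Memℓp (fun i => f (i - d)) 2) :
    ‖(⟨fun i => f (i - d), h⟩ : Hq)‖ = ‖f‖ := by
  rw [lp.norm_eq_tsum_rpow (by norm_num), lp.norm_eq_tsum_rpow (by norm_num) f]
  congr 1
  exact (Equiv.subRight d).tsum_eq (fun i => ‖f i‖ ^ (2 : ℝ≥0∞).toReal)

/-- The operator `U_{+d} : |i⟩ ↦ |i + d⟩`; see `shift_ket`. -/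
def shift (d : ℤ) : unitary Op :=
  Unitary.linearIsometryEquiv.symm
    { toFun := fun f => ⟨fun i => f (i - d), shift_memℓp d f⟩
      invFun := fun f => ⟨fun i => f (i + d), by
        have h := shift_memℓp (-d) f
        simp only [sub_neg_eq_add] at h
        exact h⟩
      map_add' := fun f g => rfl
      map_smul' := fun c f => rfl
      left_inv := fun f => by ext i; simp
      right_inv := fun f => by ext i; simp
      norm_map' := fun f => shift_norm d f _ }

lemma shift_apply (d : ℤ) (f : Hq) (i : ℤ) : (shift d : Op) f i = f (i - d) := rfl

lemma shift_ket (d i : ℤ) : (shift d : Op) (ket i) = ket (i + d) := by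
  ext j
  by_cases h : j - d = i
  · have : j = i + d := by omega
    subst this; simp [shift_apply, ket]
  · have : j ≠ i + d := by omega
    simp [shift_apply, ket, h, this]

/-- The measurement `M₀ = ∑_{i ≤ 0} |i⟩⟨i|`, `M₁ = ∑_{i ≥ 1} |i⟩⟨i|`. -/
def toyMeas : Measurement 2 where
  op := ![proj {i | i ≤ 0}, proj {i | 1 ≤ i}]
  complete := by
    simp only [Fin.sum_univ_two, Matrix.cons_val_zero, Matrix.cons_val_one, star_proj_mul_proj]
    ext ψ i
    by_cases h : i ≤ 0
    · simp [proj_apply, h, show ¬ 1 ≤ i by omega]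
    · simp [proj_apply, h, show 1 ≤ i by omega]

/-- The body of `toy`, the only declared procedure:
`if (□ m · M[q] = m → Sₘ)`, where `S₀` is `skip` and
`S₁` is `q *= U₋₁; call toy; q *= U₊₁`. -/
def toyDecl : Unit → Stmt Unit := fun _ =>
  .case toyMeas ![.skip, .seq (.unit (shift (-1))) (.seq (.call ()) (.unit (shift 1)))]

/-- The formula `{|n⟩⟨n|} call toy {|n⟩⟨n|}`. -/
def toyTriple (V : Type) (n : ℕ) : Triple V Unit :=
  ⟨(PQPT.ketbra n : PQPT (none : Option V)), .call (), PQPT.ketbra n⟩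

end QuantumRec
end

open scoped InnerProductSpace ENNReal NNReal ComplexOrder

noncomputable section

namespace QuantumRec

/-! Write Δ(X) = ∑ᵢ |i⟩⟨i| X |i⟩⟨i|. The triple {Δ(X)} call toy {Δ(X)} passes the recursion rule:
the measurement leaves diagonal operators unchanged, Δ commutes with conjugation by shifts, and the
recursive call is covered by the hypothesis with X replaced by U₊₁† X U₊₁
(`diag_mem_recConclusions`). Substituting |n⟩⟨n|, which Δ fixes, gives the goal.

Without substitution a hypothesis {P} call toy {Q} can only be weakened by the order rule. Its use
inside the body then forces inequalities between the diagonal entries pᵢ, qᵢ under any assignment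
(`recConclusions_toy`): qᵢ ≤ qᵢ₊₁ for all i, pᵢ ≤ qᵢ for i ≤ 0, and pᵢ ≤ pᵢ₋₁ for i ≥ 1. If |n⟩⟨n| ⊑
P and Q ⊑ |n⟩⟨n|, then all qᵢ ≤ 0, so pₙ ≤ p₀ ≤ q₀ ≤ 0, against pₙ ≥ 1. With no predicate variables
the substitution rule has no instances, so the same argument covers parameter-free terms. Validity
there is an induction on the approximations of the procedure (`ketbra_le_toyApprox`). -/

/-! ### Coordinates of operators and adjoints in the computational basis. -/

lemma inner_ket_left (i : ℤ) (ψ : Hq) : ⟪ket i, ψ⟫_ℂ = ψ i := by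
  simp [ket, lp.inner_single_left]

lemma ket_apply (i j : ℤ) : (ket i) j = if j = i then 1 else 0 := by
  by_cases h : j = i
  · subst h; simp [ket]
  · simp [ket, h]

lemma star_apply_ket (A : Op) (ψ : Hq) (i : ℤ) : (star A) ψ i = ⟪A (ket i), ψ⟫_ℂ := by
  rw [← inner_ket_left, ContinuousLinearMap.star_eq_adjoint,
    ContinuousLinearMap.adjoint_inner_right]

lemma star_shift_apply (d : ℤ) (ψ : Hq) (i : ℤ) : (star (shift d : Op)) ψ i = ψ (i + d) := by
  rw [star_apply_ket, shift_ket, inner_ket_left]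

lemma star_proj (s : Set ℤ) : star (proj s) = proj s := by
  ext ψ i
  rw [star_apply_ket, proj_ket, proj_apply]
  by_cases h : i ∈ s <;> simp [h, inner_ket_left]

lemma ketbra_self_apply (n : ℤ) (ψ : Hq) (i : ℤ) :
    ketbra n n ψ i = if i = n then ψ n else 0 := by
  rw [ketbra_apply, lp.coeFn_smul, Pi.smul_apply, ket_apply]
  by_cases h : i = n <;> simp [h]

/-! ### Löwner order and diagonal entries. -/

lemma conj_mono {A B : Op} (h : A ≤ B) (C : Op) : star C * A * C ≤ star C * B * C :=
  star_left_conjugate_le_conjugate h C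

lemma conj_nonneg {A : Op} (h : 0 ≤ A) (C : Op) : 0 ≤ star C * A * C :=
  star_left_conjugate_nonneg h C

lemma ketbra_nonneg (n : ℤ) : 0 ≤ ketbra n n := by
  have h : ketbra n n = star (ketbra n n) * 1 * ketbra n n := by
    ext ψ i
    rw [mul_one, mul_apply_eq_comp, star_apply_ket, ketbra_apply n n (ket i), inner_smul_left,
      inner_ket_left, ketbra_self_apply, ketbra_self_apply, ket_apply]
    by_cases h : n = i <;> simp [h, @eq_comm _ i n]
  rw [h]
  exact conj_nonneg zero_le_one _

lemma ketbra_le_one (n : ℤ) : ketbra n n ≤ 1 := by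
  rw [le_iff_inner]
  intro ψ
  rw [one_apply_eq_self, ketbra_apply, inner_smul_left, inner_ket_left,
    ← Complex.normSq_eq_conj_mul_self, ← Complex.sq_norm, inner_self_eq_norm_sq_to_K]
  have h := lp.norm_apply_le_norm (p := 2) (by norm_num) ψ n
  norm_cast
  exact Complex.real_le_real.2 (pow_le_pow_left₀ (norm_nonneg _) h 2)

/-- Diagonal entries are monotone in the Löwner order. -/
lemma re_diag_mono {A B : Op} (h : A ≤ B) (i : ℤ) : (A (ket i) i).re ≤ (B (ket i) i).re := by
  have := (Complex.le_def.1 ((le_iff_inner _ _).1 h (ket i))).1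
  rw [← inner_conj_symm, ← inner_conj_symm (B (ket i)), inner_ket_left, inner_ket_left] at this
  simpa using this

/-! ### Derivability with the substitution rule -/

/-- The complete measurement in the computational basis, `∑ᵢ |i⟩⟨i| ⋄ |i⟩⟨i|`. -/
def dephasing : SuperOp where
  ι := ℤ
  kraus := fun i => ketbra i i
  bounded := ⟨1, fun ψ => by
    rw [norm_sq_eq_tsum]
    simp [ketbra_apply, enorm_smul, enorm_ket]⟩

lemma isQOp_dephasing : dephasing.IsQOp := fun ψ => by
  rw [norm_sq_eq_tsum]
  simp [SuperOp.outTrace, dephasing, ketbra_apply, enorm_smul, enorm_ket]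

/-- Only the Kraus operator with index i contributes to coordinate i. The dual is therefore
multiplication by the diagonal of `A`, the form in which the identities below are checked. -/
lemma dual_dephasing_apply (A : Op) (ψ : Hq) (i : ℤ) :
    dephasing.dual A ψ i = A (ket i) i * ψ i := by
  rw [← inner_ket_left]
  refine (dephasing.hasSum_dual A (ket i) ψ).unique ?_
  have key : ∀ k : ℤ, ⟪ket i, (star (ketbra k k) * A * ketbra k k) ψ⟫_ℂ =
      if k = i then A (ket i) i * ψ i else 0 := fun k => by
    rw [inner_ket_left, mul_assoc, mul_apply_eq_comp, star_apply_ket, ketbra_apply, inner_smul_left,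
      inner_ket_left, ket_apply, mul_apply_eq_comp, ketbra_apply, map_smul, lp.coeFn_smul,
      Pi.smul_apply]
    by_cases h : k = i
    · subst h; simp [mul_comm]
    · simp [h]
  have h := hasSum_ite_eq i (A (ket i) i * ψ i)
  exact h.congr_fun key

namespace PQPT
variable {V : Type}

/-- The term consisting of the variable `X` alone. -/
def var (X : V) : PQPT (some X) where
  E := .ofOp 1
  F := .ofOp 0
  isQOp := fun ψ => by simp [SuperOp.outTrace_add, SuperOp.outTrace_ofOp]

/-- The term `∑ᵢ |i⟩⟨i| X |i⟩⟨i|`. -/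
def diag (X : V) : PQPT (some X) where
  E := dephasing
  F := .ofOp 0
  isQOp := fun ψ => by
    simpa [SuperOp.outTrace_add, SuperOp.outTrace_ofOp] using isQOp_dephasing ψ

lemma denote_var (v : V → QPred) (X : V) : (var X).denote v = (v X).1 := by
  simp [denote, var, base, SuperOp.dual_ofOp]

lemma denote_diag (v : V → QPred) (X : V) : (diag X).denote v = dephasing.dual (v X).1 := by
  simp [denote, diag, base, SuperOp.dual_ofOp]

lemma denote_diag_subst (v : V → QPred) (X : V) {y : Option V} (R : PQPT y) :
    ((diag X).subst R).denote v = dephasing.dual (R.denote v) := by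
  simp [denote_subst, diag, SuperOp.dual_ofOp]

lemma Le.refl {x : Option V} (P : PQPT x) : P.Le P := fun _ => le_rfl

lemma Le.of_eq {x : Option V} {P Q : PQPT x} (h : ∀ v, P.denote v = Q.denote v) : P.Le Q :=
  fun v => (h v).le

end PQPT

/-! ### Dephasing against shifts, basis projections and the measurement. -/

lemma dual_dephasing_shift (d : ℤ) (A : Op) :
    dephasing.dual (star (shift d : Op) * A * (shift d : Op)) =
      star (shift d : Op) * dephasing.dual A * (shift d : Op) := by
  ext ψ i
  simp only [dual_dephasing_apply, mul_apply_eq_comp, star_shift_apply, shift_ket, shift_apply,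
    add_sub_cancel_right]

lemma dual_dephasing_ketbra (n : ℤ) : dephasing.dual (ketbra n n) = ketbra n n := by
  ext ψ i
  rw [dual_dephasing_apply, ketbra_self_apply, ketbra_self_apply, ket_apply]
  by_cases h : i = n
  · subst h; simp
  · simp [h]

/-- A diagonal operator has no entries between the ranges of M₀ and M₁. For a bare variable X even X
⊑ M₀XM₀ + M₁XM₁ fails in general, which is why the invariant is dephased. -/
lemma dual_dephasing_case (A : Op) :
    ∑ m, star (toyMeas.op m) * dephasing.dual A * toyMeas.op m = dephasing.dual A := by
  simp only [toyMeas, Fin.sum_univ_two, Matrix.cons_val_zero, Matrix.cons_val_one, star_proj]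
  ext ψ i
  by_cases h : i ≤ 0
  · simp [proj_apply, dual_dephasing_apply, h, show ¬ 1 ≤ i by omega]
  · simp [proj_apply, dual_dephasing_apply, h, show 1 ≤ i by omega]

lemma shift_conj_shift (d : ℤ) (A : Op) :
    star (shift (-d) : Op) * (star (shift d : Op) * A * (shift d : Op)) * (shift (-d) : Op) = A := by
  have h : (shift d : Op) * (shift (-d) : Op) = 1 := by
    ext ψ i
    simp [shift_apply]
  have h' : star (shift (-d) : Op) * star (shift d : Op) = 1 := by
    rw [← star_mul, h, star_one]
  calc _ = (star (shift (-d) : Op) * star (shift d : Op)) * A *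
        ((shift d : Op) * (shift (-d) : Op)) := by simp only [mul_assoc]
    _ = A := by rw [h, h', one_mul, mul_one]

/-- The recursion rule proves `{∑ᵢ |i⟩⟨i| X |i⟩⟨i|} call toy {∑ᵢ |i⟩⟨i| X |i⟩⟨i|}`. -/
lemma diag_mem_recConclusions {V : Type} (X : V) :
    (⟨PQPT.diag X, .call (), PQPT.diag X⟩ : Triple V Unit) ∈ recConclusions True toyDecl := by
  refine ⟨some X, _, _, (), rfl, ?_⟩
  set Γ : Set (Triple V Unit) := {⟨PQPT.diag X, .call (), PQPT.diag X⟩}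
  -- The inner call must establish the precondition of the final U₊₁, namely U₊₁† Δ(X) U₊₁ = Δ(U₊₁†
  -- X U₊₁); hence this instance of the parameter.
  let R : PQPT (some X) := (PQPT.var X).pull (.ofOp (shift 1 : Op)) (isQOp_unit _)
  have hR : ∀ v : V → QPred, R.denote v = star (shift 1 : Op) * (v X).1 * (shift 1 : Op) :=
    fun v => by rw [PQPT.denote_pull, PQPT.denote_var, SuperOp.dual_ofOp]
  have hcall : QBase True Γ ⟨(PQPT.diag X).subst R, .call (), (PQPT.diag X).subst R⟩ :=
    .subst R trivial (.hyp rfl)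
  have h1 : QBase True Γ ⟨PQPT.diag X,
      .seq (.unit (shift (-1))) (.seq (.call ()) (.unit (shift 1))), PQPT.diag X⟩ := by
    refine .comp (.order (.of_eq fun v => ?_) (.unit (shift (-1)) ((PQPT.diag X).subst R)) (.refl _))
      (.comp (.order (.refl _) hcall (.of_eq fun v => ?_)) (.unit (shift 1) (PQPT.diag X)))
    -- Pulling back along U₋₁ cancels the conjugation by U₊₁.
    · rw [PQPT.denote_pull, PQPT.denote_diag_subst, hR, dual_dephasing_shift, SuperOp.dual_ofOp,
        shift_conj_shift, PQPT.denote_diag]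
    · rw [PQPT.denote_pull, PQPT.denote_diag_subst, hR, dual_dephasing_shift, SuperOp.dual_ofOp,
        PQPT.denote_diag]
  refine .order (P' := .disj (fun m => .ofOp (toyMeas.op m)) toyMeas.isQOp fun _ => PQPT.diag X)
    (.of_eq fun v => ?_) (.case toyMeas (P := fun _ => PQPT.diag X) fun m => ?_) (.refl _)
  · simp only [PQPT.denote_disj, SuperOp.dual_ofOp, PQPT.denote_diag, dual_dephasing_case]
  · fin_cases m
    · exact .skip _
    · exact h1

/-- The triple itself has no parameter, but its derivation passes through one; so some variable `X`
must exist. -/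
theorem derivable_toyTriple {V : Type} (X : V) (n : ℕ) :
    Derivable True toyDecl (toyTriple V n) := by
  have h : ∀ v : V → QPred, ((PQPT.diag X).subst (PQPT.ketbra n)).denote v =
      (PQPT.ketbra n : PQPT (none : Option V)).denote v := fun v => by
    rw [PQPT.denote_diag_subst, PQPT.denote_ketbra, dual_dephasing_ketbra]
  exact .order (.of_eq fun v => (h v).symm)
    (.subst (PQPT.ketbra n) trivial (.hyp (diag_mem_recConclusions X))) (.of_eq h)

/-! ### Underivability without the substitution rule -/

/-- A necessary condition on the denotations `A`, `B` of the assertions of a triple `{A} S {B}`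
derivable without substitution, if `c` is closed under the order rule and holds for the assertions of
the hypotheses, all about procedure calls. -/
def Provable {N : Type} (c : Op → Op → Prop) : Stmt N → Op → Op → Prop
  | .skip, A, B => A ≤ B
  | .unit U, A, B => A ≤ star (U : Op) * B * (U : Op)
  | .seq S₁ S₂, A, B => ∃ C, Provable c S₁ A C ∧ Provable c S₂ C B
  | .case M S, A, B => ∃ P : _ → Op, A ≤ ∑ m, star (M.op m) * P m * M.op m ∧
      ∀ m, Provable c (S m) (P m) B
  | .call _, A, B => c A B
  | _, _, _ => True

lemma Provable.mono {N : Type} {c : Op → Op → Prop}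
    (hc : ∀ {A A' B B' : Op}, A ≤ A' → c A' B' → B' ≤ B → c A B) (S : Stmt N) :
    ∀ {A A' B B' : Op}, A ≤ A' → Provable c S A' B' → B' ≤ B → Provable c S A B := by
  induction S with
  | bottom => intros; trivial
  | init => intros; trivial
  | skip => exact fun hA h hB => hA.trans (h.trans hB)
  | unit U => exact fun hA h hB => hA.trans (h.trans (conj_mono hB _))
  | seq S₁ S₂ ih₁ ih₂ =>
    rintro A A' B B' hA ⟨C, h₁, h₂⟩ hB
    exact ⟨C, ih₁ hA h₁ le_rfl, ih₂ le_rfl h₂ hB⟩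
  | case M S ih =>
    rintro A A' B B' hA ⟨P, hP, h⟩ hB
    exact ⟨P, hA.trans hP, fun m => ih m le_rfl (h m) hB⟩
  | call p => exact fun hA h hB => hc hA h hB

/-- Every rule except substitution acts under one fixed assignment, so a derivation can be evaluated
at `v` rule by rule. Substitution is excluded by `hV`: it is either switched off or has no variable
to act on. -/
lemma QBase.provable {V N : Type} {useSubst : Prop} (hV : useSubst → IsEmpty V)
    {Γ : Set (Triple V N)} (v : V → QPred) {c : Op → Op → Prop}
    (hc : ∀ {A A' B B' : Op}, A ≤ A' → c A' B' → B' ≤ B → c A B)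
    (hΓ : ∀ t ∈ Γ, ∃ p, t.prog = .call p ∧ c (t.pre.denote v) (t.post.denote v))
    {t : Triple V N} (h : QBase useSubst Γ t) :
    Provable c t.prog (t.pre.denote v) (t.post.denote v) := by
  induction h with
  | hyp h =>
    obtain ⟨p, hp, h⟩ := hΓ _ h
    rw [hp]
    exact h
  | bottom P => trivial
  | init P => trivial
  | skip P => exact le_rfl
  | unit U P => exact (by rw [PQPT.denote_pull, SuperOp.dual_ofOp] :
      _ = star (U : Op) * P.denote v * (U : Op)).le
  | comp _ _ ih₁ ih₂ => exact ⟨_, ih₁, ih₂⟩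
  | @case x k M P S Q _ ih =>
    refine ⟨fun m => (P m).denote v, ?_, ih⟩
    simp only [PQPT.denote_disj, SuperOp.dual_ofOp]
    exact le_rfl
  | order h₁ _ h₂ ih => exact Provable.mono hc _ (h₁ v) ih (h₂ v)
  | @subst X _ _ _ _ _ hs _ _ => exact ((hV hs).false X).elim

/-- The constraints put on an instance of the recursion rule for `toy` by its premise. -/
lemma recConclusions_toy {V : Type} {useSubst : Prop} (hV : useSubst → IsEmpty V)
    (v : V → QPred) {t : Triple V Unit} (ht : t ∈ recConclusions useSubst toyDecl) :
    (∀ i, ((t.post.denote v) (ket i) i).re ≤ ((t.post.denote v) (ket (i + 1)) (i + 1)).re) ∧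
    (∀ i ≤ 0, ((t.pre.denote v) (ket i) i).re ≤ ((t.post.denote v) (ket i) i).re) ∧
    (∀ i ≥ 1, ((t.pre.denote v) (ket i) i).re ≤ ((t.pre.denote v) (ket (i - 1)) (i - 1)).re) := by
  obtain ⟨x, P, Q, ⟨⟩, rfl, h⟩ := ht
  -- This `c` is the closure of the single hypothesis {P} call toy {Q} under the order rule.
  obtain ⟨T, hP, hT⟩ := h.provable hV v (c := fun A B => A ≤ P.denote v ∧ Q.denote v ≤ B)
    (fun hA h hB => ⟨hA.trans h.1, h.2.trans hB⟩)
    (by rintro _ rfl; exact ⟨(), rfl, le_rfl, le_rfl⟩)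
  have h0 : T 0 ≤ Q.denote v := hT 0
  -- `C` and `D` are the assertions just before and just after the recursive call.
  obtain ⟨C, h1 : T 1 ≤ _, D, ⟨h2, h3⟩, h4 : D ≤ _⟩ := hT 1
  dsimp only
  generalize P.denote v = P at *
  generalize Q.denote v = Q at *
  refine ⟨fun i => ?_, fun i hi => ?_, fun i hi => ?_⟩
  · have := re_diag_mono (h3.trans h4) i
    simpa [star_shift_apply, shift_ket] using this
  · refine (re_diag_mono hP i).trans (le_trans (le_of_eq ?_) (re_diag_mono h0 i))
    simp [Fin.sum_univ_two, toyMeas, star_proj, proj_apply, proj_ket, hi, show ¬ 1 ≤ i by omega]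
  · have := re_diag_mono (h1.trans (conj_mono h2 _)) i
    refine (re_diag_mono hP i).trans (le_trans (le_of_eq ?_) (le_trans this (le_of_eq ?_)))
    · simp [Fin.sum_univ_two, toyMeas, star_proj, proj_apply, proj_ket, hi,
        show ¬ i ≤ 0 by omega]
    · simp [star_shift_apply, shift_ket, sub_eq_add_neg]

theorem not_derivable_toyTriple {V : Type} {useSubst : Prop} (hV : useSubst → IsEmpty V) (n : ℕ) :
    ¬ Derivable useSubst toyDecl (toyTriple V n) := by
  intro h
  -- Any assignment would do; a recursion instance may still contain a parameter that has to be
  -- evaluated.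
  let v : V → QPred := fun _ => ⟨0, le_rfl, zero_le_one⟩
  have h := h.provable hV v
    (c := fun A B => ∃ t ∈ recConclusions useSubst toyDecl,
      A ≤ t.pre.denote v ∧ t.post.denote v ≤ B)
    (fun hA ⟨t, ht, h⟩ hB => ⟨t, ht, hA.trans h.1, h.2.trans hB⟩)
    (by
      intro t ht
      obtain ⟨x, P, Q, p, rfl, -⟩ := id ht
      exact ⟨p, rfl, _, ht, le_rfl, le_rfl⟩)
  -- For a bare call the necessary condition is `c` itself, so a single recursion instance `t` lies
  -- behind the whole derivation.
  obtain ⟨t, ht, h1, h2⟩ := h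
  obtain ⟨hQ, hPQ, hP⟩ := recConclusions_toy hV v ht
  simp only [toyTriple, PQPT.denote_ketbra] at h1 h2
  have hne : ∀ i : ℤ, i ≠ n → ((t.post.denote v) (ket i) i).re ≤ 0 := fun i hi => by
    simpa [ketbra_self_apply, hi] using re_diag_mono h2 i
  have hpost : ∀ i : ℤ, ((t.post.denote v) (ket i) i).re ≤ 0 := fun i => by
    -- At n itself |n⟩⟨n| gives only the bound 1; monotonicity borrows the bound 0 from n + 1.
    by_cases hi : i = n
    · exact (hQ i).trans (hne _ (by omega))
    · exact hne i hi
  have hpre : ∀ k : ℕ, ((t.pre.denote v) (ket k) k).re ≤ 0 := fun k => by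
    induction k with
    | zero => exact (hPQ _ le_rfl).trans (hpost _)
    | succ k ih =>
      have := hP (k + 1 : ℤ) (by omega)
      rw [add_sub_cancel_right] at this
      push_cast
      exact this.trans ih
  have := (re_diag_mono h1 n).trans (hpre n)
  norm_num [ketbra_self_apply, ket_apply] at this

/-! ### Validity -/

/-- The weakest liberal precondition of the `k`-th approximation of `toy`. -/
def toyApprox (k : ℕ) (A : Op) : Op :=
  wlpWith (fun _ _ => 1) (Stmt.approx toyDecl k ()) A

lemma toyApprox_zero (A : Op) : toyApprox 0 A = 1 := rfl

lemma toyApprox_succ (k : ℕ) (A : Op) : toyApprox (k + 1) A =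
    star (proj {i | i ≤ 0}) * A * proj {i | i ≤ 0} +
    star (proj {i | 1 ≤ i}) * (star (shift (-1) : Op) *
      toyApprox k (star (shift 1 : Op) * A * (shift 1 : Op)) * (shift (-1) : Op)) *
      proj {i | 1 ≤ i} := by
  simp [toyApprox, Stmt.approx, toyDecl, Stmt.unfold, wlpWith, Fin.sum_univ_two, toyMeas]

lemma unitary_conj_le_one (U : unitary Op) {A : Op} (hA : A ≤ 1) :
    star (U : Op) * A * (U : Op) ≤ 1 := by
  simpa using conj_mono hA (U : Op)

lemma toyApprox_nonneg (k : ℕ) : ∀ {A : Op}, 0 ≤ A → 0 ≤ toyApprox k A := by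
  induction k with
  | zero => exact fun _ => zero_le_one
  | succ k ih =>
    intro A hA
    rw [toyApprox_succ]
    exact add_nonneg (conj_nonneg hA _) (conj_nonneg
      (conj_nonneg (ih (conj_nonneg hA _)) _) _)

/-- Unfolding conjugates the postcondition by U₊₁, so the induction needs all `A` at once; `A ≤ 1`
is used at depth 0, where the approximation is ⊥. -/
lemma toyApprox_succ_le (k : ℕ) : ∀ {A : Op}, A ≤ 1 → toyApprox (k + 1) A ≤ toyApprox k A := by
  induction k with
  | zero =>
    intro A hA
    have h := toyMeas.complete
    simp only [Fin.sum_univ_two, toyMeas, Matrix.cons_val_zero, Matrix.cons_val_one] at h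
    rw [toyApprox_succ, toyApprox_zero, toyApprox_zero, mul_one,
      Unitary.coe_star_mul_self, mul_one, ← h]
    refine add_le_add ?_ le_rfl
    exact (conj_mono hA (proj {i | i ≤ 0})).trans_eq (by rw [mul_one])
  | succ k ih =>
    intro A hA
    have h := ih (unitary_conj_le_one (shift 1) hA)
    rw [toyApprox_succ (k + 1), toyApprox_succ k A]
    generalize toyApprox (k + 1) (star (shift 1 : Op) * A * (shift 1 : Op)) = B at h ⊢
    generalize toyApprox k (star (shift 1 : Op) * A * (shift 1 : Op)) = C at h ⊢
    exact add_le_add_right (conj_mono (conj_mono h _) _) _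

lemma shift_conj_ketbra (d n : ℤ) :
    star (shift d : Op) * ketbra n n * (shift d : Op) = ketbra (n - d) (n - d) := by
  ext ψ i
  simp only [mul_apply_eq_comp, star_shift_apply, ketbra_self_apply, shift_apply,
    eq_sub_iff_add_eq]

lemma proj_conj_ketbra {s : Set ℤ} {n : ℤ} (h : n ∈ s) :
    star (proj s) * ketbra n n * proj s = ketbra n n := by
  ext ψ i
  simp only [star_proj, mul_apply_eq_comp, proj_apply, ketbra_self_apply, Set.indicator, h, if_true]
  by_cases hi : i = n
  · simp [hi, h]
  · simp [hi]

/-- For n ≤ 0 the branch M₀ already yields |n⟩⟨n|. Otherwise the branch M₁ does: the inner call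
faces |n-1⟩⟨n-1|, and U₋₁ shifts the inductive bound back to n. The other branch only adds a
positive operator. -/
lemma ketbra_le_toyApprox (k : ℕ) : ∀ n : ℤ, ketbra n n ≤ toyApprox k (ketbra n n) := by
  induction k with
  | zero => exact ketbra_le_one
  | succ k ih =>
    intro n
    rw [toyApprox_succ, shift_conj_ketbra]
    by_cases hn : n ≤ 0
    · rw [proj_conj_ketbra (s := {i | i ≤ 0}) hn]
      exact le_add_of_nonneg_right (conj_nonneg (conj_nonneg
        (toyApprox_nonneg k (ketbra_nonneg _)) _) _)
    · have h := conj_mono (conj_mono (ih (n - 1))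
        (shift (-1) : Op)) (proj {i | 1 ≤ i})
      rw [shift_conj_ketbra, sub_neg_eq_add, sub_add_cancel,
        proj_conj_ketbra (s := {i | 1 ≤ i}) (show 1 ≤ n by omega)] at h
      exact h.trans (le_add_of_nonneg_left (conj_nonneg (ketbra_nonneg _) _))

theorem valid_toyTriple (V : Type) (n : ℕ) : Valid toyDecl (toyTriple V n) := by
  intro v
  simp only [toyTriple, PQPT.denote_ketbra]
  change ketbra n n ≤ lowerLimit fun k => toyApprox k (ketbra n n)
  -- `lowerLimit` is a choice, so nothing is known of it until a greatest lower bound is shown to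
  -- exist; this is where antitonicity and positivity enter.
  have h : IsGLB (Set.range fun k => toyApprox k (ketbra n n))
      (lowerLimit fun k => toyApprox k (ketbra n n)) :=
    Classical.epsilon_spec (exists_isGLB _
      (antitone_nat_of_succ_le fun k => toyApprox_succ_le k (ketbra_le_one _))
      fun k => toyApprox_nonneg k (ketbra_nonneg _))
  refine h.2 ?_
  rintro _ ⟨k, rfl⟩
  exact ketbra_le_toyApprox k n

end QuantumRec
end

theorem mainTheorem8 :
    -- the formula is derivable in the base system with the recursion rule
    (∀ n : ℕ, QuantumRec.Derivable True QuantumRec.toyDecl (QuantumRec.toyTriple ℕ n)) ∧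
    -- it is not derivable when the substitution rule is removed
    (∀ n : ℕ, ¬ QuantumRec.Derivable False QuantumRec.toyDecl (QuantumRec.toyTriple ℕ n)) ∧
    -- with parameter-free terms only, the formula is valid but not derivable
    (∀ n : ℕ, QuantumRec.Valid QuantumRec.toyDecl (QuantumRec.toyTriple Empty n) ∧
      ¬ QuantumRec.Derivable True QuantumRec.toyDecl (QuantumRec.toyTriple Empty n)) ∧
    -- hence the system with parameter-free terms only is incomplete
    ¬ QuantumRec.IsComplete Empty True QuantumRec.toyDecl := by
  -- Here substitution is allowed but `Empty` has no variables; the second claim uses the same lemma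
  -- with substitution switched off.
  have h (n : ℕ) : ¬ QuantumRec.Derivable True QuantumRec.toyDecl (QuantumRec.toyTriple Empty n) :=
    QuantumRec.not_derivable_toyTriple (fun _ => inferInstance) n
  exact ⟨fun n => QuantumRec.derivable_toyTriple 0 n,
    fun n => QuantumRec.not_derivable_toyTriple False.elim n,
    fun n => ⟨QuantumRec.valid_toyTriple Empty n, h n⟩,
    fun hc => h 0 (hc _ (QuantumRec.valid_toyTriple Empty 0))⟩
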